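/- **Conventions.** A (multisorted relational) signature has finitely many types and finitely many relational symbols, each symbol $R$ having an arity $\mathrm{ar}_R$, a finite (possibly empty) tuple of types. A structure $\mathbf A$ of this signature has a set $A_t$ for each type $t$ and a relation $R^{\mathbf A}\subseteq A_{\mathrm{ar}_R(1)}\times\dots\times A_{\mathrm{ar}_R(m)}$ for each symbol $R$; elements of distinct types are regarded as distinct. A homomorphism $\mathbf A\to\mathbf B$ is a family of maps $A_t\to B_t$ preserving all relations; we write $\mathbf A\to\mathbf B$ if one exists. A promise template is a pair of structures $\mathbf A,\mathbf A'$ of the same signature with $\mathbf A$ finite and $\mathbf A\to\mathbf A'$ ($\mathbf A'$ may be infinite). $\mathrm{PCSP}(\mathbf A,\mathbf A')$ is the promise problem whose instances are the finite structures $\mathbf X$ of that signature, positive if $\mathbf X\to\mathbf A$ and negative if $\mathbf X\not\to\mathbf A'$. A map $\psi$ on structures is a reduction from $\mathrm{PCSP}(\mathbf A,\mathbf A')$ to $\mathrm{PCSP}(\mathbf B,\mathbf B')$ if, for every instance $\mathbf X$, $\mathbf X\to\mathbf A$ implies $\psi(\mathbf X)\to\mathbf B$, and $\mathbf X\not\to\mathbf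 A'$ implies $\psi(\mathbf X)\not\to\mathbf B'$. **Datalog reductions.** A Datalog program with input signature $\Pi$ consists of finitely many new symbols whose arities are tuples of $\Pi$-types, finitely many rules $t_0\leftarrow t_1,\dots,t_r$ ($r\ge 0$) of atomic formulae in typed variables, where $t_1,\dots,t_r$ may use the symbols of $\Pi$, the new symbols and equality, while $t_0$ uses a new symbol, and an output symbol (a symbol of $\Pi$ or a new one). On input $\mathbf X$ it outputs the interpretation of the output symbol in the least fixed point of the rules. A Datalog interpretation $\phi$ of $\Sigma$ into $\Pi$ consists of programs $\phi_t$, $\phi_R$ with input signature $\Pi$ for the types $t$ and symbols $R$ of $\Sigma$, such that the arity of $\phi_R$ is the concatenation of the arities of $\phi_{\mathrm{ar}_R(1)},\phi_{\mathrm{ar}_R(2)},\dots$; the $\Sigma$-structure $\phi(\mathbf X)$ has domains $\phi_t(\mathbf X)$, and a tuple of elements of the appropriate domains is in $R^{\phi(\mathbf X)}$ if its concatenation is in $\phi_R(\mathbf X)$. A union gadget $\upsilon$ from $\Pi$ to $\Sigma$ is a map $d$ from $\Pi$-types to $\Sigma$-types and a map $r$ from $\Pi$-symbols to $\Sigma$-symbols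 with $\mathrm{ar}_{r(R)}=d\circ\mathrm{ar}_R$; the $t$-th domain of $\upsilon(\mathbf X)$ is the disjoint union of the $X_i$ with $d(i)=t$, and $S^{\upsilon(\mathbf X)}=\bigcup_{r(R)=S}R^{\mathbf X}$. We write $\mathrm{PCSP}(\mathbf A,\mathbf A')\le_{\mathsf{DL}}\mathrm{PCSP}(\mathbf B,\mathbf B')$ if $\upsilon\circ\phi$ is a reduction between the two problems for some Datalog interpretation $\phi$ and some union gadget $\upsilon$ (through any finite intermediate signature). **The $k$-consistency reduction.** Given $\mathbf X$, start with $\mathcal F_K$ being the set of all partial homomorphisms from $K$ to $\mathbf A$ (type-preserving maps that preserve all constraints of $\mathbf X$ with all entries in $K$), for each set $K$ of at most $k$ elements of $\mathbf X$. As long as possible, for $L\subseteq K$ remove from $\mathcal F_L$ the maps with no extension in $\mathcal F_K$, and from $\mathcal F_K$ the maps whose restriction to $L$ is not in $\mathcal F_L$. Then $\kappa_k^{\mathbf A,\mathbf B}(\mathbf X)$ is obtained from the disjoint union of the powers $\mathbf B^{\mathcal F_K}$, with elements $(K;b)$, by identifying $(K;b\circ\rho)$ with $(L;b)$ for all $L\subseteq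 K$ and $b\colon\mathcal F_L\to B_t$, where $\rho\colon\mathcal F_K\to\mathcal F_L$ is the restriction. $\mathrm{PCSP}(\mathbf A,\mathbf A')$ reduces to $\mathrm{PCSP}(\mathbf B,\mathbf B')$ by the $k$-consistency reduction if $\kappa_k^{\mathbf A,\mathbf B}$ is a reduction between the two problems. **Statement.** Let $\mathbf A,\mathbf A'$ and $\mathbf B,\mathbf B'$ be promise templates, possibly of different signatures. Then $\mathrm{PCSP}(\mathbf A,\mathbf A')\le_{\mathsf{DL}}\mathrm{PCSP}(\mathbf B,\mathbf B')$ if and only if there exists $k\ge 1$ such that $\mathrm{PCSP}(\mathbf A,\mathbf A')$ reduces to $\mathrm{PCSP}(\mathbf B,\mathbf B')$ by the $k$-consistency reduction. -/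

import Mathlib

universe u v w

namespace PCSP

/-! ### Multisorted signatures, structures, homomorphisms -/

/-- A multisorted relational signature: types, symbols, and for each symbol its arity, which is a
tuple of types. -/
structure Signature where
  Ty : Type
  Sym : Type
  ar : Sym → List Ty

/-- A signature is finite if it has finitely many types and finitely many symbols. -/
def Signature.IsFinite (σ : Signature) : Prop := Finite σ.Ty ∧ Finite σ.Sym

/-- A relational structure. Tuples are lists of typed elements, and `typed` says that
`rel R ⊆ Dom (ar R 1) × ⋯ × Dom (ar R k)`. -/
structure RelStr (σ : Signature) where
  Dom : σ.Ty → Type u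
  rel : σ.Sym → Set (List (Sigma Dom))
  typed : ∀ R l, l ∈ rel R → l.map Sigma.fst = σ.ar R

/-- The elements of a structure (of all types; elements of distinct types are distinct). -/
abbrev RelStr.Elem {σ : Signature} (A : RelStr.{u} σ) : Type u := Sigma A.Dom

/-- All domains are finite (only used over finite signatures). -/
def RelStr.IsFinite {σ : Signature} (A : RelStr.{u} σ) : Prop := ∀ t, Finite (A.Dom t)

/-- A type-preserving and relation-preserving collection of maps. -/
structure Hom {σ : Signature} (A : RelStr.{u} σ) (B : RelStr.{v} σ) where
  toFun : ∀ t, A.Dom t → B.Dom t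
  map_rel : ∀ R l, l ∈ A.rel R → l.map (fun x => (⟨x.1, toFun x.1 x.2⟩ : B.Elem)) ∈ B.rel R

/-- `A → B`: there is a homomorphism from `A` to `B`. -/
def HomTo {σ : Signature} (A : RelStr.{u} σ) (B : RelStr.{v} σ) : Prop := Nonempty (Hom A B)

/-- The `I`-fold power of a structure. -/
def RelStr.power {σ : Signature} (B : RelStr.{u} σ) (I : Type v) : RelStr.{max u v} σ where
  Dom t := I → B.Dom t
  rel R := {l | l.map Sigma.fst = σ.ar R ∧
    ∀ i : I, l.map (fun x => (⟨x.1, x.2 i⟩ : B.Elem)) ∈ B.rel R}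
  typed _ _ h := h.1

/-! ### Reductions between promise CSPs -/

/-- `ψ` is a reduction from `PCSP(A, A')` to `PCSP(B, B')`: on all instances, i.e. finite
structures `X`, it maps positive instances (`X → A`) to positive instances, and negative instances
(`X ↛ A'`) to negative instances. -/
def IsReduction {σ τ : Signature} (A : RelStr.{0} σ) (A' : RelStr.{u} σ)
    (B : RelStr.{0} τ) (B' : RelStr.{v} τ) (ψ : RelStr.{0} σ → RelStr.{0} τ) : Prop :=
  ∀ X : RelStr.{0} σ, X.IsFinite →
    (HomTo X A → HomTo (ψ X) B) ∧ (¬ HomTo X A' → ¬ HomTo (ψ X) B')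

/-! ### Datalog -/

/-- Atomic formulae over the signature `δ`, in variables `V` with types given by `ty`. -/
inductive Atom (δ : Signature) {V : Type} (ty : V → δ.Ty) : Type
  | rel (R : δ.Sym) (args : List V) (h : args.map ty = δ.ar R) : Atom δ ty
  | eq (x y : V) (h : ty x = ty y) : Atom δ ty

/-- The variables of an atomic formula. -/
def Atom.vars {δ : Signature} {V : Type} {ty : V → δ.Ty} : Atom δ ty → List V
  | .rel _ args _ => args
  | .eq x y _ => [x, y]

/-- The signature `σ` extended by new symbols (IDBs) with the given arities. -/
def Signature.extend (σ : Signature) (Idb : Type) (idbAr : Idb → List σ.Ty) : Signature where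
  Ty := σ.Ty
  Sym := σ.Sym ⊕ Idb
  ar := Sum.elim σ.ar idbAr

/-- A Datalog rule `head ← body`: the head is an IDB atom, the body is a list of atoms over the
extended signature, and `Var` is the set of variables that occur in the rule. -/
structure Rule (σ : Signature) (Idb : Type) (idbAr : Idb → List σ.Ty) where
  Var : Type
  varFinite : Finite Var
  ty : Var → σ.Ty
  head : Idb
  headArgs : List Var
  head_typed : headArgs.map ty = idbAr head
  body : List (Atom (σ.extend Idb idbAr) ty)
  occurs : ∀ x : Var, x ∈ headArgs ∨ ∃ a ∈ body, x ∈ a.vars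

/-- A Datalog program with input signature `σ`: finitely many IDBs, finitely many rules, and an
output symbol. -/
structure Program (σ : Signature) where
  Idb : Type
  idbFinite : Finite Idb
  idbAr : Idb → List σ.Ty
  RuleIdx : Type
  ruleFinite : Finite RuleIdx
  rule : RuleIdx → Rule σ Idb idbAr
  out : σ.Sym ⊕ Idb

namespace Program

variable {σ : Signature}

/-- The arity of a program is the arity of its output symbol. -/
def arity (P : Program σ) : List σ.Ty := (σ.extend P.Idb P.idbAr).ar P.out

/-- Fixed-point semantics: `P.Derives A S l` means that the tuple `l` belongs to the symbol `S` in
the fixed point that `P` computes on the input `A`. -/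
inductive Derives (P : Program σ) (A : RelStr.{u} σ) : σ.Sym ⊕ P.Idb → List A.Elem → Prop
  | input (R : σ.Sym) (l : List A.Elem) (hl : l ∈ A.rel R) : Derives P A (Sum.inl R) l
  | rule (r : P.RuleIdx) (h : ∀ x : (P.rule r).Var, A.Dom ((P.rule r).ty x))
      (hrel : ∀ S args hargs, Atom.rel S args hargs ∈ (P.rule r).body →
        Derives P A S (args.map (fun x => ⟨(P.rule r).ty x, h x⟩)))
      (heq : ∀ x y hxy, Atom.eq x y hxy ∈ (P.rule r).body →
        (⟨(P.rule r).ty x, h x⟩ : A.Elem) = ⟨(P.rule r).ty y, h y⟩) :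
      Derives P A (Sum.inr (P.rule r).head)
        ((P.rule r).headArgs.map (fun x => ⟨(P.rule r).ty x, h x⟩))

/-- The output relation of a program. -/
def eval (P : Program σ) (A : RelStr.{u} σ) : Set (List A.Elem) := {l | P.Derives A P.out l}

end Program

/-- A Datalog interpretation mapping `σ`-structures to `τ`-structures. -/
structure Interpretation (σ τ : Signature) where
  tyProg : τ.Ty → Program σ
  symProg : τ.Sym → Program σ
  arity_eq : ∀ R, (symProg R).arity = (τ.ar R).flatMap (fun t => (tyProg t).arity)

/-- The structure `φ(A)`: the `t`-th domain is the relation computed by the program for `t`, and a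
tuple of such tuples is in `R` if its concatenation is in the relation computed by the program for
`R`. -/
def Interpretation.apply {σ τ : Signature} (φ : Interpretation σ τ) (A : RelStr.{u} σ) :
    RelStr.{u} τ where
  Dom t := {l : List A.Elem // l ∈ (φ.tyProg t).eval A}
  rel R := {w | w.map Sigma.fst = τ.ar R ∧ w.flatMap (fun e => e.2.1) ∈ (φ.symProg R).eval A}
  typed _ _ h := h.1

/-- A union gadget `(d, r)`. -/
structure UnionGadget (σ τ : Signature) where
  d : σ.Ty → τ.Ty
  r : σ.Sym → τ.Sym
  ar_eq : ∀ R, τ.ar (r R) = (σ.ar R).map d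

/-- The structure `υ(A)`: the `t`-th domain is the disjoint union of the domains `A_i` with
`d i = t`, and `S` is the union of the relations `R` with `r R = S`. -/
def UnionGadget.apply {σ τ : Signature} (υ : UnionGadget σ τ) (A : RelStr.{u} σ) :
    RelStr.{u} τ where
  Dom t := {x : A.Elem // υ.d x.1 = t}
  rel S := {w | ∃ R, υ.r R = S ∧ ∃ l ∈ A.rel R, w = l.map (fun x => ⟨υ.d x.1, x, rfl⟩)}
  typed := by
    rintro S w ⟨R, rfl, l, hl, rfl⟩
    rw [υ.ar_eq, ← A.typed R l hl, List.map_map, List.map_map]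
    rfl

/-- `PCSP(A, A') ≤_DL PCSP(B, B')`: some composition of a Datalog interpretation and a union gadget
(through some finite intermediate signature) is a reduction. -/
def DatalogReduces {σ τ : Signature} (A : RelStr.{0} σ) (A' : RelStr.{u} σ)
    (B : RelStr.{0} τ) (B' : RelStr.{v} τ) : Prop :=
  ∃ (δ : Signature) (_ : δ.IsFinite) (φ : Interpretation σ δ) (υ : UnionGadget δ τ),
    IsReduction A A' B B' (fun X => υ.apply (φ.apply X))

/-! ### The `k`-consistency reduction -/

section Consistency

variable {σ τ : Signature}

/-- Type-preserving maps from a finite set `K` of elements of `X` to `A`. -/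
abbrev PartialMap (X : RelStr.{u} σ) (A : RelStr.{v} σ) (K : Finset X.Elem) : Type (max u v) :=
  ∀ x : {x // x ∈ K}, A.Dom x.1.1

/-- The restriction of a map to a subset. -/
def PartialMap.restrict {X : RelStr.{u} σ} {A : RelStr.{v} σ} {K L : Finset X.Elem} (hLK : L ⊆ K)
    (f : PartialMap X A K) : PartialMap X A L :=
  fun x => f ⟨x.1, hLK x.2⟩

/-- Partial homomorphisms: the constraints of `X` with all entries in `K` are preserved. -/
def PartialMap.IsPartialHom {X : RelStr.{u} σ} {A : RelStr.{v} σ} {K : Finset X.Elem}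
    (f : PartialMap X A K) : Prop :=
  ∀ R (l : List {x // x ∈ K}), l.map Subtype.val ∈ X.rel R →
    l.map (fun x => (⟨x.1.1, f x⟩ : A.Elem)) ∈ A.rel R

/-- The subsets of `X` with at most `k` elements. -/
abbrev SmallSet (X : RelStr.{u} σ) (k : ℕ) : Type u := {K : Finset X.Elem // K.card ≤ k}

/-- The maps that the `k`-consistency algorithm discards: those that are not partial homomorphisms,
and then, repeatedly, those on `K` whose restriction to some `L ⊆ K` is discarded and those on
`L ⊆ K` all of whose extensions to `K` are discarded. -/
inductive Removed (k : ℕ) (X : RelStr.{u} σ) (A : RelStr.{v} σ) :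
    ∀ K : SmallSet X k, PartialMap X A K.1 → Prop
  | start (K : SmallSet X k) (f : PartialMap X A K.1) (hf : ¬ f.IsPartialHom) : Removed k X A K f
  | restriction (K L : SmallSet X k) (hLK : L.1 ⊆ K.1) (g : PartialMap X A K.1)
      (hg : Removed k X A L (g.restrict hLK)) : Removed k X A K g
  | extension (K L : SmallSet X k) (hLK : L.1 ⊆ K.1) (f : PartialMap X A L.1)
      (hf : ∀ g : PartialMap X A K.1, g.restrict hLK = f → Removed k X A K g) :
      Removed k X A L f

/-- The set `𝓕_K` of the maps that remain when the `k`-consistency algorithm has stopped. -/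
def Surviving (k : ℕ) (X : RelStr.{u} σ) (A : RelStr.{v} σ) (K : SmallSet X k) :
    Type (max u v) :=
  {f : PartialMap X A K.1 // ¬ Removed k X A K f}

/-- The restriction map `𝓕_K → 𝓕_L` for `L ⊆ K`. -/
def Surviving.restrict {k : ℕ} {X : RelStr.{u} σ} {A : RelStr.{v} σ} {K L : SmallSet X k}
    (hLK : L.1 ⊆ K.1) (f : Surviving k X A K) : Surviving k X A L :=
  ⟨f.1.restrict hLK, fun h => f.2 (Removed.restriction K L hLK f.1 h)⟩

/-- The elements `(K; b)` of type `t`, with `b : 𝓕_K → B_t`, before identification. -/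
abbrev PreDom (k : ℕ) (X : RelStr.{u} σ) (A : RelStr.{v} σ) (B : RelStr.{w} τ) (t : τ.Ty) :=
  Σ K : SmallSet X k, (Surviving k X A K → B.Dom t)

/-- The identifications of `(K; b ∘ ρ)` with `(L; b)` for `L ⊆ K` and the restriction map `ρ`. -/
inductive Glue (k : ℕ) (X : RelStr.{u} σ) (A : RelStr.{v} σ) (B : RelStr.{w} τ) (t : τ.Ty) :
    PreDom k X A B t → PreDom k X A B t → Prop
  | mk (K L : SmallSet X k) (hLK : L.1 ⊆ K.1) (b : Surviving k X A L → B.Dom t) :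
      Glue k X A B t ⟨K, fun f => b (f.restrict hLK)⟩ ⟨L, b⟩

/-- The output `κ_k^{A,B}(X)` of the `k`-consistency reduction: the copies of the powers `B ^ 𝓕_K`,
glued along the identifications `Glue` (`Quot` is the quotient by the equivalence relation that
`Glue` generates). -/
def kappa (k : ℕ) (A : RelStr.{v} σ) (B : RelStr.{w} τ) (X : RelStr.{u} σ) :
    RelStr.{max u v w} τ where
  Dom t := Quot (Glue k X A B t)
  rel S := {z | ∃ K : SmallSet X k, ∃ l ∈ (B.power (Surviving k X A K)).rel S,
    z = l.map (fun x => ⟨x.1, Quot.mk _ ⟨K, x.2⟩⟩)}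
  typed := by
    rintro S z ⟨K, l, hl, rfl⟩
    rw [← (B.power (Surviving k X A K)).typed S l hl, List.map_map]
    rfl

end Consistency

/-- `PCSP(A, A')` reduces to `PCSP(B, B')` by the `k`-consistency reduction. -/
def ConsistencyReduces {σ τ : Signature} (k : ℕ) (A : RelStr.{0} σ) (A' : RelStr.{u} σ)
    (B : RelStr.{0} τ) (B' : RelStr.{v} τ) : Prop :=
  IsReduction A A' B B' (kappa k A B)

end PCSP

/-! Both directions compare the output of the consistency reduction with the output of a Datalog
reduction by a homomorphism. Positive instances cause no trouble: restrictions of a homomorphism to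
`A` survive the consistency algorithm, and evaluating at them maps `kappa` to `B`.

From Datalog to consistency, the given reduction is applied to the instance `A` itself, which gives
a homomorphism g from υ(φ(A)) to `B`. Let k bound the numbers of variables and the arities of all
programs of φ. Surviving maps preserve every derived fact (`Program.Derives.app_of_surviving`), so
they send elements of φ(X) to elements of φ(A), and g then gives values in `B`. These values are
compatible with restriction, so υ(φ(X)) maps to `kappa` (`homTo_kappa_of_sizeLE`).

From consistency to Datalog, the programs are canonical: their new symbols are all relations on `A`
of arity at most N, and their rules are all those in at most N variables that hold in `A`. A partial
map is `Consistent` if it satisfies all derived facts. Completeness (`canon_of_forall_consistent`)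
says that whatever holds under all consistent maps on a set of at most N elements is derived; hence
consistent maps extend, survive, and do not separate identified elements of `kappa`
(`Consistent.eq_of_eqvGen`). An element (K; b) is then coded as an enumeration of K together with a
partial function from tuples of `A` to `B`. This maps `kappa` to the Datalog output (`kappa_homTo`),
while soundness preserves positive instances (`homTo_of_homTo`). -/

namespace PCSP

variable {σ τ : Signature}

/-! ### Partial maps applied to tuples -/

/-- The image of a tuple of elements of `K` under a partial map on `K`. -/
def PartialMap.app {X : RelStr.{u} σ} {A : RelStr.{v} σ} {K : Finset X.Elem}
    (f : PartialMap X A K) (l : List {x // x ∈ K}) : List A.Elem :=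
  l.map (fun x => ⟨x.1.1, f x⟩)

/-- The inclusion of a subset. -/
def incl {α : Type u} {L K : Finset α} (h : L ⊆ K) (x : {x // x ∈ L}) : {x // x ∈ K} :=
  ⟨x.1, h x.2⟩

theorem PartialMap.restrict_app {X : RelStr.{u} σ} {A : RelStr.{v} σ} {K L : Finset X.Elem}
    (h : L ⊆ K) (f : PartialMap X A K) (l : List {x // x ∈ L}) :
    (f.restrict h).app l = f.app (l.map (incl h)) := by
  simp only [PartialMap.app, List.map_map]
  rfl

theorem PartialMap.map_fst_app {X : RelStr.{u} σ} {A : RelStr.{v} σ} {K : Finset X.Elem}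
    (f : PartialMap X A K) (l : List {x // x ∈ K}) :
    (f.app l).map Sigma.fst = (l.map Subtype.val).map Sigma.fst := by
  simp only [PartialMap.app, List.map_map]
  rfl

/-- Every surviving map on `L ⊆ K` extends to a surviving map on `K`. -/
theorem Surviving.exists_extension {k : ℕ} {X : RelStr.{u} σ} {A : RelStr.{v} σ}
    {K L : SmallSet X k} (hLK : L.1 ⊆ K.1) (f : Surviving k X A L) :
    ∃ g : Surviving k X A K, g.restrict hLK = f := by
  by_contra hne
  refine f.2 (Removed.extension K L hLK f.1 fun g hg => ?_)
  by_contra hg'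
  exact hne ⟨⟨g, hg'⟩, Subtype.ext hg⟩

theorem Surviving.isPartialHom {k : ℕ} {X : RelStr.{u} σ} {A : RelStr.{v} σ}
    {K : SmallSet X k} (f : Surviving k X A K) : f.1.IsPartialHom := by
  by_contra h
  exact f.2 (Removed.start K f.1 h)

/-- The restriction of a homomorphism to a finite set. -/
def Hom.toPartialMap {X : RelStr.{u} σ} {A : RelStr.{v} σ} (h : Hom X A) (K : Finset X.Elem) :
    PartialMap X A K :=
  fun x => h.toFun x.1.1 x.1.2

/-- The restrictions of a homomorphism survive the consistency algorithm. -/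
theorem not_removed_toPartialMap {k : ℕ} {X : RelStr.{u} σ} {A : RelStr.{v} σ} (h : Hom X A)
    (K : SmallSet X k) : ¬ Removed k X A K (h.toPartialMap K.1) := by
  -- Induction on `Removed` needs the map as a free index.
  suffices H : ∀ (K : SmallSet X k) (f : PartialMap X A K.1), Removed k X A K f →
      f ≠ h.toPartialMap K.1 from fun hr => H K _ hr rfl
  intro K f hr
  induction hr with
  | start K f hf =>
    rintro rfl
    apply hf
    intro R l hl
    have := h.map_rel R _ hl
    rwa [List.map_map] at this
  | restriction K L hLK g hg ih =>
    rintro rfl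
    exact ih rfl
  | extension K L hLK f hf ih =>
    rintro rfl
    exact ih (h.toPartialMap K.1) rfl rfl

/-- The restriction of a homomorphism, as a surviving map. -/
def Hom.toSurviving {k : ℕ} {X : RelStr.{u} σ} {A : RelStr.{v} σ} (h : Hom X A)
    (K : SmallSet X k) : Surviving k X A K :=
  ⟨h.toPartialMap K.1, not_removed_toPartialMap h K⟩

/-- `κ` preserves positive instances. -/
theorem homTo_kappa_of_homTo {k : ℕ} {X A : RelStr.{0} σ} {B : RelStr.{0} τ} (h : HomTo X A) :
    HomTo (kappa k A B X) B := by
  obtain ⟨h⟩ := h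
  -- Evaluation at the restriction of h respects gluing because these restrictions form a compatible
  -- family.
  refine ⟨⟨fun t => Quot.lift (fun p => p.2 (h.toSurviving p.1)) ?_, ?_⟩⟩
  · rintro _ _ ⟨K, L, hLK, b⟩
    rfl
  · rintro S _ ⟨K, l, hl, rfl⟩
    have := hl.2 (h.toSurviving K)
    refine Eq.mp (congrArg (· ∈ B.rel S) ?_) this
    clear hl this
    induction l with
    | nil => rfl
    | cons x l ih => exact congrArg (List.cons _) ih

/-! ### Preservation of derived facts by surviving maps -/

/-- All rules of the program have at most `k` variables. -/
def Program.WidthLE (P : Program σ) (k : ℕ) : Prop :=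
  ∀ r, Nat.card (P.rule r).Var ≤ k

theorem Program.exists_widthLE (P : Program σ) : ∃ k, P.WidthLE k := by
  have := P.ruleFinite
  obtain ⟨k, hk⟩ := (Set.finite_range fun r => Nat.card (P.rule r).Var).bddAbove
  exact ⟨k, fun r => hk ⟨r, rfl⟩⟩

theorem Program.WidthLE.mono {P : Program σ} {k n : ℕ} (h : P.WidthLE k) (hkn : k ≤ n) :
    P.WidthLE n := fun r => (h r).trans hkn

theorem Program.Derives.typed {P : Program σ} {X : RelStr.{u} σ} {S : σ.Sym ⊕ P.Idb}
    {l : List X.Elem} (h : P.Derives X S l) :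
    l.map Sigma.fst = (σ.extend P.Idb P.idbAr).ar S := by
  cases h with
  | input R l hl => exact X.typed R l hl
  | rule r h hrel heq =>
    rw [List.map_map]
    exact (P.rule r).head_typed

/-- Facts derived by a program of width at most `k` are preserved by all maps that survive the
`k`-consistency algorithm. -/
theorem Program.Derives.app_of_surviving {P : Program σ} {k : ℕ} (hP : P.WidthLE k)
    {X : RelStr.{u} σ} {A : RelStr.{v} σ} {S : σ.Sym ⊕ P.Idb} {l : List X.Elem}
    (h : P.Derives X S l) (K : SmallSet X k) (f : Surviving k X A K) (l' : List {x // x ∈ K.1})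
    (hl' : l'.map Subtype.val = l) : P.Derives A S (f.1.app l') := by
  classical
  -- K must vary: the body is checked on the set of all rule variables, not on the set carrying the
  -- head.
  induction h generalizing K with
  | input R l hl =>
    subst hl'
    exact .input R _ (f.isPartialHom R l' hl)
  | rule r h hrel heq ih =>
    have := (P.rule r).varFinite
    have := Fintype.ofFinite (P.rule r).Var
    let e : (P.rule r).Var → X.Elem := fun x => ⟨(P.rule r).ty x, h x⟩
    let L : SmallSet X k := ⟨Finset.univ.image e, Finset.card_image_le.trans (by
      simpa using hP r)⟩
    -- f and the rule's variables share at least the head entries M. Restricting f to M and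
    -- extending to L gives a surviving g that satisfies the body and agrees with f on the head.
    let M : SmallSet X k := ⟨((P.rule r).headArgs.map e).toFinset,
      (Finset.card_le_card (by
        intro x hx
        simp only [List.mem_toFinset, List.mem_map] at hx
        obtain ⟨a, -, rfl⟩ := hx
        exact Finset.mem_image_of_mem e (Finset.mem_univ a))).trans L.2⟩
    have hML : M.1 ⊆ L.1 := by
      intro x hx
      simp only [M, List.mem_toFinset, List.mem_map] at hx
      obtain ⟨a, -, rfl⟩ := hx
      exact Finset.mem_image_of_mem e (Finset.mem_univ a)
    have hMK : M.1 ⊆ K.1 := by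
      intro x hx
      simp only [M, List.mem_toFinset] at hx
      have hx' : x ∈ l'.map Subtype.val := hl' ▸ hx
      obtain ⟨a, -, rfl⟩ := List.mem_map.1 hx'
      exact a.2
    obtain ⟨g, hg⟩ := (f.restrict hMK).exists_extension hML
    let eL : (P.rule r).Var → {x // x ∈ L.1} :=
      fun x => ⟨e x, Finset.mem_image_of_mem e (Finset.mem_univ x)⟩
    have key := Program.Derives.rule (P := P) (A := A) r (fun x => g.1 (eL x))
      (fun S args hargs hmem => by
        have := ih S args hargs hmem L g (args.map eL) (by rw [List.map_map]; rfl)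
        simp only [PartialMap.app, List.map_map] at this
        exact this)
      (fun x y hxy hmem => by
        have hxy' : eL x = eL y := Subtype.ext (heq x y hxy hmem)
        exact congrArg (fun z : {x // x ∈ L.1} => (⟨z.1.1, g.1 z⟩ : A.Elem)) hxy')
    convert key using 1
    have hgf : ∀ (x : X.Elem) (hK : x ∈ K.1) (hL : x ∈ L.1), x ∈ M.1 →
        f.1 ⟨x, hK⟩ = g.1 ⟨x, hL⟩ := fun x hK hL hM =>
      (congrFun (congrArg Subtype.val hg) ⟨x, hM⟩).symm
    apply List.ext_getElem
    · have := congrArg List.length hl'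
      simpa [PartialMap.app] using this
    · intro i h1 h2
      simp only [PartialMap.app, List.length_map] at h1 h2
      have hi : (l'[i]).1 = e ((P.rule r).headArgs[i]) := by
        have := List.getElem_of_eq hl' (i := i) (by simpa using h1)
        simpa using this
      simp only [PartialMap.app, List.getElem_map]
      have : ∀ (a : {x // x ∈ K.1}) (b : {x // x ∈ L.1}), a.1 = b.1 → a.1 ∈ M.1 →
          (⟨a.1.1, f.1 a⟩ : A.Elem) = ⟨b.1.1, g.1 b⟩ := by
        rintro ⟨a, ha⟩ ⟨b, hb⟩ hab haM
        obtain rfl : a = b := hab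
        exact congrArg (Sigma.mk a.1) (hgf a ha hb haM)
      refine this _ (eL _) hi ?_
      rw [hi]
      simp only [M, List.mem_toFinset]
      exact List.mem_map_of_mem (List.getElem_mem _)

/-! ### Tuples in the relations of the constructions, as images of lists -/

theorem map_eq_map_map {α β γ : Type*} (l : List α) (f : α → β) (g : β → γ) (h : α → γ)
    (H : ∀ x, h x = g (f x)) : l.map h = (l.map f).map g := by
  rw [List.map_map]
  exact List.map_congr_left fun x _ => H x

theorem Hom.map_mem {A : RelStr.{u} σ} {B : RelStr.{v} σ} (g : Hom A B) {ι : Type w}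
    {R : σ.Sym} {l : List ι} {F : ι → A.Elem} (h : l.map F ∈ A.rel R) :
    l.map (fun e => (⟨(F e).1, g.toFun _ (F e).2⟩ : B.Elem)) ∈ B.rel R := by
  have := g.map_rel R _ h
  rwa [List.map_map] at this

theorem HomTo.trans {A : RelStr.{u} σ} {B : RelStr.{v} σ} {C : RelStr.{w} σ} (h : HomTo A B)
    (h' : HomTo B C) : HomTo A C := by
  obtain ⟨e⟩ := h
  obtain ⟨f⟩ := h'
  refine ⟨⟨fun t x => f.toFun t (e.toFun t x), fun R l hl => ?_⟩⟩
  have := f.map_rel R _ (e.map_rel R l hl)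
  rwa [List.map_map] at this

/-- The inclusion of a structure in the output of a union gadget. -/
def UnionGadget.inj (υ : UnionGadget σ τ) {A : RelStr.{u} σ} (x : A.Elem) : (υ.apply A).Elem :=
  ⟨υ.d x.1, x, rfl⟩

theorem UnionGadget.map_mem (υ : UnionGadget σ τ) {A : RelStr.{u} σ} {ι : Type w}
    {R : σ.Sym} {l : List ι} {F : ι → A.Elem} (h : l.map F ∈ A.rel R) :
    l.map (fun e => υ.inj (F e)) ∈ (υ.apply A).rel (υ.r R) :=
  ⟨R, rfl, _, h, map_eq_map_map _ _ _ _ fun _ => rfl⟩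

theorem Interpretation.map_mem (φ : Interpretation σ τ) {A : RelStr.{u} σ} {ι : Type w}
    {R : τ.Sym} {l : List ι} {F : ι → (φ.apply A).Elem}
    (hty : l.map (fun e => (F e).1) = τ.ar R)
    (hd : l.flatMap (fun e => (F e).2.1) ∈ (φ.symProg R).eval A) :
    l.map F ∈ (φ.apply A).rel R :=
  ⟨(map_eq_map_map l F Sigma.fst _ fun _ => rfl).symm.trans hty,
    Eq.mp (congrArg (· ∈ (φ.symProg R).eval A)
      (List.flatMap_map F (fun e : (φ.apply A).Elem => e.2.1) l).symm) hd⟩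

theorem kappa_map_mem {k : ℕ} {X : RelStr.{u} σ} {A : RelStr.{v} σ} {B : RelStr.{w} τ}
    {ι : Type*} {S : τ.Sym} {l : List ι} (K : SmallSet X k) (t : ι → τ.Ty)
    (b : ∀ e, Surviving k X A K → B.Dom (t e)) (hty : l.map t = τ.ar S)
    (hb : ∀ f, l.map (fun e => (⟨t e, b e f⟩ : B.Elem)) ∈ B.rel S) :
    l.map (fun e => (⟨t e, Quot.mk _ ⟨K, b e⟩⟩ : (kappa k A B X).Elem)) ∈
      (kappa k A B X).rel S :=
  ⟨K, l.map fun e => ⟨t e, b e⟩,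
    ⟨(map_eq_map_map l (fun e => (⟨t e, b e⟩ : (B.power _).Elem)) Sigma.fst _
      fun _ => rfl).symm.trans hty, fun f =>
      Eq.mp (congrArg (· ∈ B.rel S) (map_eq_map_map _ _ _ _ fun _ => rfl)) (hb f)⟩,
    map_eq_map_map _ _ _ _ fun _ => rfl⟩

/-! ### Datalog reductions are consistency reductions -/

theorem exists_nat_forall_le {ι : Type*} [Finite ι] (f : ι → ℕ) : ∃ k, ∀ i, f i ≤ k := by
  obtain ⟨k, hk⟩ := (Set.finite_range f).bddAbove
  exact ⟨k, fun i => hk ⟨i, rfl⟩⟩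

/-- All programs of an interpretation have width and arity at most `k`. -/
structure Interpretation.SizeLE {δ : Signature} (φ : Interpretation σ δ) (k : ℕ) : Prop where
  ty_width : ∀ t, (φ.tyProg t).WidthLE k
  sym_width : ∀ R, (φ.symProg R).WidthLE k
  ty_arity : ∀ t, (φ.tyProg t).arity.length ≤ k
  sym_arity : ∀ R, (φ.symProg R).arity.length ≤ k

theorem Interpretation.exists_sizeLE {δ : Signature} (hδ : δ.IsFinite)
    (φ : Interpretation σ δ) : ∃ k, 1 ≤ k ∧ φ.SizeLE k := by
  have := hδ.1
  have := hδ.2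
  choose f hf using fun t => (φ.tyProg t).exists_widthLE
  choose g hg using fun R => (φ.symProg R).exists_widthLE
  obtain ⟨a, ha⟩ := exists_nat_forall_le f
  obtain ⟨b, hb⟩ := exists_nat_forall_le g
  obtain ⟨c, hc⟩ := exists_nat_forall_le fun t => (φ.tyProg t).arity.length
  obtain ⟨d, hd⟩ := exists_nat_forall_le fun R => (φ.symProg R).arity.length
  -- The summand 1 only ensures that k is positive.
  refine ⟨a + b + c + d + 1, by omega, ⟨?_, ?_, ?_, ?_⟩⟩
  · exact fun t => (hf t).mono ((ha t).trans (by omega))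
  · exact fun R => (hg R).mono ((hb R).trans (by omega))
  · exact fun t => (hc t).trans (by omega)
  · exact fun R => (hd R).trans (by omega)

theorem Program.Derives.length_eq {P : Program σ} {X : RelStr.{u} σ} {l : List X.Elem}
    (h : P.Derives X P.out l) : l.length = P.arity.length := by
  rw [Program.arity, ← h.typed, List.length_map]

open Classical in
/-- The set of entries of a short tuple. -/
noncomputable def SmallSet.ofList {X : RelStr.{u} σ} {k : ℕ} (l : List X.Elem)
    (hl : l.length ≤ k) : SmallSet X k :=
  ⟨l.toFinset, l.toFinset_card_le.trans hl⟩

theorem SmallSet.mem_ofList {X : RelStr.{u} σ} {k : ℕ} {l : List X.Elem}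
    {hl : l.length ≤ k} {x : X.Elem} : x ∈ (SmallSet.ofList l hl).1 ↔ x ∈ l := by
  simp [SmallSet.ofList]

/-- A tuple, as a tuple of elements of a set that contains its entries. -/
def lift {α : Type u} {K : Finset α} (l : List α) (h : ∀ x ∈ l, x ∈ K) : List {x // x ∈ K} :=
  l.attach.map fun x => ⟨x.1, h x.1 x.2⟩

theorem map_val_lift {α : Type u} {K : Finset α} (l : List α) (h : ∀ x ∈ l, x ∈ K) :
    (lift l h).map Subtype.val = l := by
  simp only [lift, List.map_map]
  exact List.attach_map_subtype_val l

theorem map_incl_lift {α : Type u} {K L : Finset α} (hLK : L ⊆ K) (l : List α)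
    (h : ∀ x ∈ l, x ∈ L) : (lift l h).map (incl hLK) = lift l fun x hx => hLK (h x hx) := by
  simp only [lift, List.map_map]
  rfl

theorem lift_flatMap {α : Type u} {ι : Type v} {K : Finset α} (w : List ι) (g : ι → List α)
    (h : ∀ e ∈ w, ∀ x ∈ g e, x ∈ K) (h' : ∀ x ∈ w.flatMap g, x ∈ K) :
    lift (w.flatMap g) h' = w.attach.flatMap fun e => lift (g e.1) (h e.1 e.2) := by
  apply List.map_injective_iff.2 Subtype.val_injective
  rw [map_val_lift, List.map_flatMap]
  simp only [map_val_lift]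
  conv_lhs => rw [← w.attach_map_subtype_val, List.flatMap_map]

/-! ### Mapping υ(φ(X)) to `kappa` -/

section

variable {δ : Signature} {φ : Interpretation σ δ} {υ : UnionGadget δ τ} {k : ℕ}
  {A X : RelStr.{0} σ} {B : RelStr.{0} τ}

/-- The image of an element of `φ(X)` under a surviving map whose domain contains its entries. -/
def Interpretation.pushElem (hφ : φ.SizeLE k) (K : SmallSet X k) (x : (φ.apply X).Elem)
    (hx : ∀ y ∈ x.2.1, y ∈ K.1) (f : Surviving k X A K) : (φ.apply A).Elem :=
  ⟨x.1, f.1.app (lift x.2.1 hx),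
    Program.Derives.app_of_surviving (hφ.ty_width x.1) x.2.2 K f _ (map_val_lift _ _)⟩

/-- A map and its restriction agree on tuples inside the smaller set; this is the compatibility that
`Glue` asks for. -/
theorem Interpretation.pushElem_restrict (hφ : φ.SizeLE k) {K L : SmallSet X k} (hLK : L.1 ⊆ K.1)
    (x : (φ.apply X).Elem) (hx : ∀ y ∈ x.2.1, y ∈ L.1) (f : Surviving k X A K) :
    φ.pushElem hφ L x hx (f.restrict hLK) = φ.pushElem hφ K x (fun y hy => hLK (hx y hy)) f := by
  simp only [Interpretation.pushElem]
  congr 2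
  rw [← map_incl_lift hLK x.2.1 hx]
  exact PartialMap.restrict_app hLK f.1 _

/-- The value at a surviving map of the element of `κ` that corresponds to an element of
`υ(φ(X))`. -/
def pushVal (hφ : φ.SizeLE k) (g : Hom (υ.apply (φ.apply A)) B) (K : SmallSet X k)
    (x : (φ.apply X).Elem) (hx : ∀ y ∈ x.2.1, y ∈ K.1) (f : Surviving k X A K) :
    B.Dom (υ.d x.1) :=
  g.toFun (υ.d x.1) ⟨φ.pushElem hφ K x hx f, rfl⟩

theorem pushVal_restrict (hφ : φ.SizeLE k) (g : Hom (υ.apply (φ.apply A)) B)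
    {K L : SmallSet X k} (hLK : L.1 ⊆ K.1) (x : (φ.apply X).Elem) (hx : ∀ y ∈ x.2.1, y ∈ L.1)
    (f : Surviving k X A K) :
    pushVal hφ g L x hx (f.restrict hLK) = pushVal hφ g K x (fun y hy => hLK (hx y hy)) f := by
  simp only [pushVal]
  congr 1
  exact Subtype.ext (Interpretation.pushElem_restrict hφ hLK x hx f)

theorem Interpretation.SizeLE.length_le (hφ : φ.SizeLE k) (x : (φ.apply X).Elem) :
    x.2.1.length ≤ k :=
  (Program.Derives.length_eq x.2.2).le.trans (hφ.ty_arity x.1)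

/-- The element of `κ` that corresponds to an element of `υ(φ(X))`. -/
noncomputable def pushClass (hφ : φ.SizeLE k) (g : Hom (υ.apply (φ.apply A)) B)
    (x : (φ.apply X).Elem) : (kappa k A B X).Elem :=
  ⟨υ.d x.1, Quot.mk _ ⟨SmallSet.ofList x.2.1 (hφ.length_le x),
    pushVal hφ g _ x fun _ hy => SmallSet.mem_ofList.2 hy⟩⟩

/-- Gluing makes the class independent of the set, so the entries of a related tuple can all be
moved to one common set. -/
theorem pushClass_eq (hφ : φ.SizeLE k) (g : Hom (υ.apply (φ.apply A)) B) (K : SmallSet X k)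
    (x : (φ.apply X).Elem) (hx : ∀ y ∈ x.2.1, y ∈ K.1) :
    pushClass hφ g x = ⟨υ.d x.1, Quot.mk _ ⟨K, pushVal hφ g K x hx⟩⟩ := by
  have hLK : (SmallSet.ofList x.2.1 (hφ.length_le x)).1 ⊆ K.1 :=
    fun y hy => hx y (SmallSet.mem_ofList.1 hy)
  refine congrArg (Sigma.mk (β := (kappa k A B X).Dom) (υ.d x.1)) ?_
  refine (Quot.sound ?_).symm
  have := Glue.mk (B := B) (t := υ.d x.1) K _ hLK
    (pushVal hφ g _ x fun _ hy => SmallSet.mem_ofList.2 hy)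
  simp only [pushVal_restrict] at this
  exact this

/-- If `υ(φ(A)) → B` then `υ(φ(X))` maps to the output of the `k`-consistency reduction, for all
large enough `k`. -/
theorem homTo_kappa_of_sizeLE (hφ : φ.SizeLE k) (g : Hom (υ.apply (φ.apply A)) B) :
    HomTo (υ.apply (φ.apply X)) (kappa k A B X) := by
  refine ⟨⟨fun t x => x.2 ▸ (pushClass hφ g x.1).2, ?_⟩⟩
  rintro _ _ ⟨R, rfl, w, hw, rfl⟩
  have hmap : ∀ (l : List (φ.apply X).Elem), (l.map fun x =>
      (⟨υ.d x.1, x, rfl⟩ : (υ.apply (φ.apply X)).Elem)).map (fun x =>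
        (⟨x.1, x.2.2 ▸ (pushClass hφ g x.2.1).2⟩ : (kappa k A B X).Elem)) =
      l.map (pushClass hφ g) := by
    intro l
    rw [List.map_map]
    rfl
  refine Eq.mp (congrArg (· ∈ (kappa k A B X).rel (υ.r R)) (hmap w).symm) ?_
  obtain ⟨hty, hd⟩ := hw
  replace hty : w.map (fun e : (φ.apply X).Elem => e.1) = δ.ar R := hty
  let c : List X.Elem := w.flatMap fun e => e.2.1
  -- The bound on the arities of the relation programs is what lets a single small set hold all
  -- entries of the related tuple.
  have hlen : c.length ≤ k := (Program.Derives.length_eq hd).le.trans (hφ.sym_arity R)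
  let K : SmallSet X k := SmallSet.ofList c hlen
  have hcK : ∀ y ∈ c, y ∈ K.1 := fun y hy => SmallSet.mem_ofList.2 hy
  have hK : ∀ e ∈ w, ∀ y ∈ e.2.1, y ∈ K.1 := fun e he y hy =>
    hcK y (List.mem_flatMap.2 ⟨e, he, hy⟩)
  have hcl : w.map (pushClass hφ g) = w.attach.map fun e =>
      (⟨υ.d e.1.1, Quot.mk _ ⟨K, pushVal hφ g K e.1 (hK e.1 e.2)⟩⟩ : (kappa k A B X).Elem) := by
    conv_lhs => rw [← w.attach_map_subtype_val, List.map_map]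
    exact List.map_congr_left fun e _ => pushClass_eq hφ g K e.1 (hK e.1 e.2)
  have hty' : w.attach.map (fun e => e.1.1) = δ.ar R := by
    rw [← hty]
    conv_rhs => rw [← w.attach_map_subtype_val, List.map_map]
    rfl
  rw [hcl]
  refine kappa_map_mem K (fun e : {x // x ∈ w} => υ.d e.1.1) _ ?_ fun f => ?_
  · rw [υ.ar_eq, ← hty', List.map_map]
    rfl
  · refine g.map_mem (υ.map_mem (φ.map_mem (F := fun e : {x // x ∈ w} =>
      φ.pushElem hφ K e.1 (hK e.1 e.2) f) hty' ?_))
    have := Program.Derives.app_of_surviving (hφ.sym_width R) hd K f (lift c hcK)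
      (map_val_lift _ _)
    rw [lift_flatMap w _ hK hcK, PartialMap.app, List.map_flatMap] at this
    exact this

end

theorem exists_consistencyReduces {A : RelStr.{0} σ} {A' : RelStr.{u} σ} {B : RelStr.{0} τ}
    {B' : RelStr.{v} τ} (hA : A.IsFinite) (h : DatalogReduces A A' B B') :
    ∃ k : ℕ, 1 ≤ k ∧ ConsistencyReduces k A A' B B' := by
  obtain ⟨δ, hδ, φ, υ, h⟩ := h
  obtain ⟨k, hk, hφ⟩ := φ.exists_sizeLE hδ
  -- `A` is finite, hence an instance, and the identity makes it a positive one.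
  obtain ⟨g⟩ := (h A hA).1 ⟨⟨fun _ x => x, fun R l hl => by simpa using hl⟩⟩
  refine ⟨k, hk, fun X hX => ⟨homTo_kappa_of_homTo, fun hn hκ => (h X hX).2 hn ?_⟩⟩
  exact (homTo_kappa_of_sizeLE hφ g).trans hκ

/-! ### The canonical Datalog program of a finite structure -/

/-- Prescribed types fix the length. This makes the symbols and rule shapes of the canonical program
finite by instance inference. -/
instance finite_list_map_eq {α β : Type*} [Finite α] (f : α → β) (s : List β) :
    Finite {l : List α // l.map f = s} :=
  Set.Finite.subset (List.finite_length_eq α s.length) fun l (hl : l.map f = s) => by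
    rw [Set.mem_ofPred_eq, ← hl, List.length_map]

instance finite_list_length_le {α : Type*} [Finite α] (n : ℕ) :
    Finite {l : List α // l.length ≤ n} :=
  List.finite_length_le α n

/-- The rules do not see the output symbol, so canonical programs with different outputs derive the
same facts. -/
theorem Program.Derives.with_out {P : Program σ} {X : RelStr.{u} σ} {S : σ.Sym ⊕ P.Idb}
    {l : List X.Elem} (h : P.Derives X S l) (o : σ.Sym ⊕ P.Idb) :
    ({P with out := o} : Program σ).Derives X S l := by
  induction h with
  | input R l hl => exact .input R l hl
  | rule r h hrel heq ih => exact .rule (P := {P with out := o}) r h ih heq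

theorem PartialMap.eq_of_app_eq {X : RelStr.{u} σ} {A : RelStr.{v} σ} {K : Finset X.Elem}
    {f g : PartialMap X A K} {l : List {x // x ∈ K}} (hl : ∀ x, x ∈ l)
    (h : f.app l = g.app l) : f = g := by
  funext x
  have := List.map_inj_left.1 h x (hl x)
  exact eq_of_heq (Sigma.mk.inj this).2

/-- The elements of a finite set, as a list. -/
noncomputable def enum {X : RelStr.{u} σ} (K : Finset X.Elem) : List {x // x ∈ K} :=
  K.attach.toList

theorem mem_enum {X : RelStr.{u} σ} {K : Finset X.Elem} (x : {x // x ∈ K}) : x ∈ enum K := by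
  simp [enum]

theorem length_enum {X : RelStr.{u} σ} (K : Finset X.Elem) : (enum K).length = K.card := by
  simp [enum]

/-- The tuples of elements of `A` with the given types. -/
abbrev Tup (A : RelStr.{0} σ) (s : List σ.Ty) : Type := {l : List A.Elem // l.map Sigma.fst = s}

/-- The new symbols of the canonical program: all relations on `A` of arity at most `N`. -/
abbrev CanonIdb (A : RelStr.{0} σ) (N : ℕ) : Type :=
  Σ s : {s : List σ.Ty // s.length ≤ N}, Set (Tup A s.1)

/-- The intended interpretation in `A` of the symbols of the canonical program. -/
def Sat (A : RelStr.{0} σ) (N : ℕ) : σ.Sym ⊕ CanonIdb A N → List A.Elem → Prop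
  | .inl R, l => l ∈ A.rel R
  | .inr P, l => ∃ h : l.map Sigma.fst = P.1.1, (⟨l, h⟩ : Tup A P.1.1) ∈ P.2

/-- The arities of the symbols of the canonical program. -/
def canonAr (A : RelStr.{0} σ) (N : ℕ) : σ.Sym ⊕ CanonIdb A N → List σ.Ty :=
  Sum.elim σ.ar fun P => P.1.1

/-- The body atoms and the head of a rule in `n ≤ N` variables. -/
abbrev RuleShape (A : RelStr.{0} σ) (N : ℕ) : Type :=
  Σ n : Fin (N + 1), Σ ty : Fin n → σ.Ty,
    Set (Σ S : σ.Sym ⊕ CanonIdb A N, {args : List (Fin n) // args.map ty = canonAr A N S}) ×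
      Σ P : CanonIdb A N, {args : List (Fin n) // args.map ty = P.1.1}

/-- The rule holds in `A`, under the intended interpretation of the new symbols. -/
def RuleShape.Sound {A : RelStr.{0} σ} {N : ℕ} (r : RuleShape A N) : Prop :=
  ∀ g : ∀ x, A.Dom (r.2.1 x),
    (∀ a ∈ r.2.2.1, Sat A N a.1 (a.2.1.map fun x => ⟨r.2.1 x, g x⟩)) →
      Sat A N (.inr r.2.2.2.1) (r.2.2.2.2.1.map fun x => ⟨r.2.1 x, g x⟩)

section Canon

variable [Finite σ.Ty] [Finite σ.Sym] (A : RelStr.{0} σ) [∀ t, Finite (A.Dom t)] (N : ℕ)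

/-- The canonical program: all rules in at most `N` variables that hold in `A`. The trivial
equations in the bodies make all variables occur. -/
noncomputable def canon (out : σ.Sym ⊕ CanonIdb A N) : Program σ where
  Idb := CanonIdb A N
  idbFinite := inferInstance
  idbAr P := P.1.1
  RuleIdx := {r : RuleShape A N // r.Sound}
  ruleFinite := inferInstance
  rule r :=
    { Var := Fin r.1.1
      varFinite := inferInstance
      ty := r.1.2.1
      head := r.1.2.2.2.1
      headArgs := r.1.2.2.2.2.1
      head_typed := r.1.2.2.2.2.2
      body := (Set.toFinite r.1.2.2.1).toFinset.toList.map
          (fun a => Atom.rel a.1 a.2.1 a.2.2) ++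
        (List.finRange r.1.1).map fun x => Atom.eq x x rfl
      occurs := fun x => .inr ⟨Atom.eq x x rfl, List.mem_append_right _
        (List.mem_map.2 ⟨x, List.mem_finRange x, rfl⟩), by simp [Atom.vars]⟩ }
  out := out

/-- The facts that the canonical program derives. -/
def Canon (X : RelStr.{u} σ) (S : σ.Sym ⊕ CanonIdb A N) (l : List X.Elem) : Prop :=
  (canon A N S).Derives X S l

variable {A N} {X : RelStr.{u} σ}

theorem derives_canon_of_derives_canon {o o' S : σ.Sym ⊕ CanonIdb A N} {l : List X.Elem}
    (h : (canon A N o).Derives X S l) : (canon A N o').Derives X S l :=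
  h.with_out o'

theorem canon_of_rule (r : RuleShape A N) (hr : r.Sound) (h : ∀ x, X.Dom (r.2.1 x))
    (hb : ∀ a ∈ r.2.2.1, Canon A N X a.1 (a.2.1.map fun x => ⟨r.2.1 x, h x⟩)) :
    Canon A N X (.inr r.2.2.2.1) (r.2.2.2.2.1.map fun x => ⟨r.2.1 x, h x⟩) := by
  refine Program.Derives.rule (P := canon A N (.inr r.2.2.2.1)) ⟨r, hr⟩ h ?_ ?_
  · intro S args hargs hmem
    rcases List.mem_append.1 hmem with hm | hm
    · obtain ⟨a, ha, he⟩ := List.mem_map.1 hm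
      cases he
      exact derives_canon_of_derives_canon (hb a (by simpa using ha))
    · obtain ⟨x, -, he⟩ := List.mem_map.1 hm
      cases he
  · intro x y hxy hmem
    rcases List.mem_append.1 hmem with hm | hm
    · obtain ⟨a, ha, he⟩ := List.mem_map.1 hm
      cases he
    · obtain ⟨x, -, he⟩ := List.mem_map.1 hm
      cases he
      rfl

/-- Soundness of the canonical program. -/
theorem Canon.sat_map {S : σ.Sym ⊕ CanonIdb A N} {l : List X.Elem} (hS : Canon A N X S l)
    (h : Hom X A) : Sat A N S (l.map fun x => ⟨x.1, h.toFun x.1 x.2⟩) := by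
  -- In `Canon` the output equals the derived symbol; the induction needs a fixed output and a
  -- varying symbol.
  suffices H : ∀ o S l, (canon A N o).Derives X S l →
      Sat A N S (l.map fun x => ⟨x.1, h.toFun x.1 x.2⟩) from H _ _ _ hS
  intro o S l hd
  induction hd with
  | input R l hl => exact h.map_rel R l hl
  | rule r g hrel heq ih =>
    have := r.2 (fun x => h.toFun _ (g x)) fun a ha => by
      have := ih a.1 a.2.1 a.2.2 (List.mem_append_left _
        (List.mem_map.2 ⟨a, by simpa using ha, rfl⟩))
      exact Eq.mp (congrArg (Sat A N a.1) (map_eq_map_map a.2.1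
        (fun x => (⟨r.1.2.1 x, g x⟩ : X.Elem)) _ _ fun _ => rfl).symm) this
    exact Eq.mp (congrArg (Sat A N _) (map_eq_map_map r.1.2.2.2.2.1
      (fun x => (⟨r.1.2.1 x, g x⟩ : X.Elem)) _ _ fun _ => rfl)) this

/-! ### Completeness of the canonical program -/

/-- The partial maps that satisfy all derived facts. -/
def Consistent (N : ℕ) (M : Finset X.Elem) (h : PartialMap X A M) : Prop :=
  ∀ S (l : List {x // x ∈ M}), Canon A N X S (l.map Subtype.val) → Sat A N S (h.app l)

theorem Consistent.restrict {L M : Finset X.Elem} (hLM : L ⊆ M) {h : PartialMap X A M}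
    (hh : Consistent N M h) : Consistent N L (h.restrict hLM) := by
  intro S l hS
  rw [PartialMap.restrict_app]
  refine hh S _ ?_
  rw [List.map_map]
  exact hS

/-- A relation that contains the images of a tuple under all consistent maps is derived. -/
theorem canon_of_forall_consistent {M : Finset X.Elem} (hM : M.card ≤ N) (P : CanonIdb A N)
    (l : List {x // x ∈ M}) (hl : (l.map Subtype.val).map Sigma.fst = P.1.1)
    (H : ∀ h : PartialMap X A M, Consistent N M h → Sat A N (.inr P) (h.app l)) :
    Canon A N X (.inr P) (l.map Subtype.val) := by
  let e : Fin M.card ≃ {x // x ∈ M} := M.equivFin.symm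
  let ν : Fin M.card → X.Elem := fun x => (e x).1
  let body : Set (Σ S : σ.Sym ⊕ CanonIdb A N,
      {args : List (Fin M.card) // args.map (fun x => (ν x).1) = canonAr A N S}) :=
    {a | Canon A N X a.1 (a.2.1.map ν)}
  have hback : ∀ l : List {x // x ∈ M}, (l.map e.symm).map e = l := fun l => by simp
  have hval : ∀ l : List {x // x ∈ M}, (l.map e.symm).map ν = l.map Subtype.val := fun l => by
    conv_rhs => rw [← hback l, List.map_map]
    rfl
  have hty : ∀ l : List {x // x ∈ M},
      (l.map e.symm).map (fun x => (ν x).1) = (l.map Subtype.val).map Sigma.fst := fun l => by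
    rw [← hval, List.map_map (f := ν)]
    rfl
  -- The variables are the elements of M, and the body lists every derived fact about them.
  -- Assignments satisfying the body are thus exactly the consistent maps on M, so the hypothesis
  -- says that the rule is sound.
  let r : RuleShape A N := ⟨⟨M.card, Nat.lt_succ_of_le hM⟩, fun x => (ν x).1, body,
    P, l.map e.symm, (hty l).trans hl⟩
  have hr : r.Sound := by
    intro g hg
    let h : PartialMap X A M := Equiv.piCongrLeft (fun m : {x // x ∈ M} => A.Dom m.1.1) e g
    have hhe : ∀ x, h (e x) = g x := 
      Equiv.piCongrLeft_apply_apply (fun m : {x // x ∈ M} => A.Dom m.1.1) e g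
    have happ : ∀ l : List {x // x ∈ M},
        (l.map e.symm).map (fun x => (⟨(ν x).1, g x⟩ : A.Elem)) = h.app l := fun l => by
      conv_rhs => rw [← hback l, PartialMap.app, List.map_map]
      refine List.map_congr_left fun x _ => ?_
      exact congrArg (Sigma.mk (ν x).1) (hhe x).symm
    have := H h fun S l' hS => by
      have ht : (l'.map Subtype.val).map Sigma.fst = canonAr A N S := by
        rw [Program.Derives.typed hS]
        cases S <;> rfl
      have hb : (⟨S, l'.map e.symm, (hty l').trans ht⟩ : Σ S : σ.Sym ⊕ CanonIdb A N,
          {args : List (Fin M.card) // args.map (fun x => (ν x).1) = canonAr A N S}) ∈ body := by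
        change Canon A N X S _
        rw [hval]
        exact hS
      have := hg _ hb
      rw [← happ]
      exact this
    rw [← happ] at this
    exact this
  have := canon_of_rule (X := X) r hr (fun x => (ν x).2) fun a ha => ha
  rw [← hval]
  exact this

/-- The set of restrictions to L of consistent maps on M is itself a symbol of the program. By
completeness it is derived at the enumeration of L, so every consistent map on L belongs to it. -/
theorem Consistent.exists_extension {L M : Finset X.Elem} (hLM : L ⊆ M) (hM : M.card ≤ N)
    {h : PartialMap X A L} (hh : Consistent N L h) :
    ∃ g : PartialMap X A M, Consistent N M g ∧ g.restrict hLM = h := by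
  let P : CanonIdb A N := ⟨⟨((enum L).map Subtype.val).map Sigma.fst, by
      simpa [length_enum] using (Finset.card_le_card hLM).trans hM⟩,
    {q | ∃ g : PartialMap X A M, Consistent N M g ∧ g.app ((enum L).map (incl hLM)) = q.1}⟩
  have hval : ((enum L).map (incl hLM)).map Subtype.val = (enum L).map Subtype.val := by
    rw [List.map_map]
    rfl
  have hP := canon_of_forall_consistent hM P ((enum L).map (incl hLM)) (by rw [hval])
    fun g hg => ⟨by rw [PartialMap.map_fst_app, hval], g, hg, rfl⟩
  rw [hval] at hP
  obtain ⟨_, g, hg, hgh⟩ := hh _ _ hP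
  exact ⟨g, hg, PartialMap.eq_of_app_eq mem_enum
    ((PartialMap.restrict_app hLM g _).trans hgh)⟩

/-- Consistent maps are partial homomorphisms closed under restriction and extendable to all small
sets; the algorithm never discards a member of such a family. -/
theorem Consistent.not_removed {k : ℕ} (hk : k ≤ N) {K : SmallSet X k} {f : PartialMap X A K.1}
    (hf : Consistent N K.1 f) : ¬ Removed k X A K f := by
  intro hr
  induction hr with
  | start K f hn => exact hn fun R l hl => hf (.inl R) l (.input R _ hl)
  | restriction K L hLK g hg ih => exact ih (hf.restrict hLK)
  | extension K L hLK f _ ih =>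
    obtain ⟨g, hg, hgf⟩ := hf.exists_extension hLK (K.2.trans hk)
    exact ih g hgf hg

/-- The restriction of a consistent map to a small set survives. -/
def Consistent.toSurviving {k : ℕ} (hk : k ≤ N) {M : Finset X.Elem} {h : PartialMap X A M}
    (hh : Consistent N M h) (K : SmallSet X k) (hK : K.1 ⊆ M) : Surviving k X A K :=
  ⟨h.restrict hK, (hh.restrict hK).not_removed hk⟩

/-- Identified elements have the same value at all consistent maps. -/
theorem Consistent.eq_of_eqvGen {k : ℕ} (hk : k ≤ N) (hk3 : 3 * k ≤ N) {B : RelStr.{w} τ}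
    {t : τ.Ty} {p q : PreDom k X A B t} (hpq : Relation.EqvGen (Glue k X A B t) p q)
    {M : Finset X.Elem} {h : PartialMap X A M} (hh : Consistent N M h)
    (hp : p.1.1 ⊆ M) (hq : q.1.1 ⊆ M) :
    p.2 (hh.toSurviving hk p.1 hp) = q.2 (hh.toSurviving hk q.1 hq) := by
  classical
  induction hpq generalizing M with
  | rel p q hpq =>
    cases hpq
    rfl
  | refl p => rfl
  | symm p q _ ih => exact (ih hh hq hp).symm
  | trans p q r _ _ ih₁ ih₂ =>
    -- The middle set of the chain need not lie in M, and adding it to M could exceed N. Forgetting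
    -- the rest of M first leaves at most 3k elements.
    have hL : p.1.1 ∪ r.1.1 ⊆ M := Finset.union_subset hp hq
    have hLU : p.1.1 ∪ r.1.1 ⊆ p.1.1 ∪ r.1.1 ∪ q.1.1 := Finset.subset_union_left
    obtain ⟨g, hg, hgh⟩ := (hh.restrict hL).exists_extension hLU (by
      have h1 := Finset.card_union_le (p.1.1 ∪ r.1.1) q.1.1
      have h2 := Finset.card_union_le p.1.1 r.1.1
      have := p.1.2
      have := q.1.2
      have := r.1.2
      omega)
    have hpU := Finset.subset_union_left.trans hLU
    have hrU := Finset.subset_union_right.trans hLU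
    have hqU : q.1.1 ⊆ p.1.1 ∪ r.1.1 ∪ q.1.1 := Finset.subset_union_right
    have e1 : hg.toSurviving hk p.1 hpU = hh.toSurviving hk p.1 hp :=
      Subtype.ext (congrArg (PartialMap.restrict Finset.subset_union_left) hgh)
    have e2 : hg.toSurviving hk r.1 hrU = hh.toSurviving hk r.1 hq :=
      Subtype.ext (congrArg (PartialMap.restrict Finset.subset_union_right) hgh)
    rw [← e1, ← e2, ih₁ hg hpU hqU, ih₂ hg hqU hrU]

end Canon

/-! ### Consistency reductions are Datalog reductions -/

/-- The types of the intermediate signature: partial functions from tuples of elements of `A` to a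
domain of `B`. -/
abbrev FunTy (A : RelStr.{0} σ) (B : RelStr.{0} τ) (k : ℕ) : Type :=
  Σ t : τ.Ty, Σ s : {s : List σ.Ty // s.length ≤ k}, Tup A s.1 → Option (B.Dom t)

/-- The symbols of the intermediate signature: tuples of partial functions that match the arity of
a symbol of `B`. -/
abbrev FunSym (A : RelStr.{0} σ) (B : RelStr.{0} τ) (k : ℕ) : Type :=
  Σ S : τ.Sym, {i : List (FunTy A B k) // i.map Sigma.fst = τ.ar S}

/-- The intermediate signature. -/
def funSig (A : RelStr.{0} σ) (B : RelStr.{0} τ) (k : ℕ) : Signature where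
  Ty := FunTy A B k
  Sym := FunSym A B k
  ar R := R.2.1

/-- The union gadget that forgets everything but the types and symbols of `B`. -/
def funGadget (A : RelStr.{0} σ) (B : RelStr.{0} τ) (k : ℕ) :
    UnionGadget (funSig A B k) τ where
  d := Sigma.fst
  r := Sigma.fst
  ar_eq R := R.2.2.symm

/-- A partial function together with an argument of the right types. -/
abbrev FunTup (A : RelStr.{0} σ) (B : RelStr.{0} τ) (k : ℕ) : Type :=
  Σ i : FunTy A B k, Tup A i.2.1.1

/-- The value of a partial function. -/
def FunTup.val {A : RelStr.{0} σ} {B : RelStr.{0} τ} {k : ℕ} (x : FunTup A B k) :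
    Option B.Elem :=
  (x.1.2.2 x.2).map (Sigma.mk x.1.1)

/-- The partial functions prescribe the lengths of the blocks, so a concatenation can be cut in only
one way. -/
theorem FunTup.eq_of_flatMap_eq {A : RelStr.{0} σ} {B : RelStr.{0} τ} {k : ℕ} :
    ∀ {w w' : List (FunTup A B k)}, w.map Sigma.fst = w'.map Sigma.fst →
      w.flatMap (fun x => x.2.1) = w'.flatMap (fun x => x.2.1) → w = w'
  | [], [], _, _ => rfl
  | [], _ :: _, h, _ => by simp at h
  | _ :: _, [], h, _ => by simp at h
  | ⟨i, a⟩ :: w, ⟨j, b⟩ :: w', h, hf => by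
    simp only [List.map_cons, List.cons.injEq] at h
    obtain ⟨rfl, h⟩ := h
    simp only [List.flatMap_cons] at hf
    have hlen : a.1.length = b.1.length := by
      simpa using congrArg List.length (a.2.trans b.2.symm)
    obtain ⟨hab, hf⟩ := List.append_inj hf hlen
    rw [Subtype.ext hab, FunTup.eq_of_flatMap_eq h hf]

/-- The domain of a partial function. -/
def domIdb {A : RelStr.{0} σ} {B : RelStr.{0} τ} {k N : ℕ} (hk : k ≤ N) (i : FunTy A B k) :
    CanonIdb A N :=
  ⟨⟨i.2.1.1, i.2.1.2.trans hk⟩, {q | (i.2.2 q).isSome}⟩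

theorem length_flatMap_le {A : RelStr.{0} σ} {B : RelStr.{0} τ} {k : ℕ}
    (l : List (FunTy A B k)) : (l.flatMap fun i => i.2.1.1).length ≤ l.length * k := by
  rw [List.length_flatMap]
  refine (List.sum_le_card_nsmul _ k ?_).trans (by simp)
  intro n hn
  obtain ⟨i, -, rfl⟩ := List.mem_map.1 hn
  exact i.2.1.2

/-- The preimage of a relation of `B` under a tuple of partial functions. -/
def relIdb {A : RelStr.{0} σ} {B : RelStr.{0} τ} {k N : ℕ}
    (hN : ∀ S, ((τ.ar S).length + 1) * k ≤ N) (R : FunSym A B k) : CanonIdb A N :=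
  ⟨⟨R.2.1.flatMap fun i => i.2.1.1, (length_flatMap_le R.2.1).trans (by
      have hlen : R.2.1.length = (τ.ar R.1).length := by
        simpa using congrArg List.length R.2.2
      rw [hlen]
      exact (Nat.mul_le_mul_right k (Nat.le_succ _)).trans (hN R.1))⟩,
    -- The equation with `some` also forces every partial function to be defined at its block.
    {q | ∃ w : List (FunTup A B k), w.map Sigma.fst = R.2.1 ∧
      w.flatMap (fun x => x.2.1) = q.1 ∧ ∃ z ∈ B.rel R.1, z.map some = w.map FunTup.val}⟩

/-- The entries of a small set. -/
noncomputable def SmallSet.list {X : RelStr.{u} σ} {k : ℕ} (K : SmallSet X k) : List X.Elem :=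
  (enum K.1).map Subtype.val

theorem SmallSet.mem_list {X : RelStr.{u} σ} {k : ℕ} {K : SmallSet X k} {x : X.Elem} :
    x ∈ K.list ↔ x ∈ K.1 := by
  simp [SmallSet.list, mem_enum]

theorem SmallSet.length_list {X : RelStr.{u} σ} {k : ℕ} (K : SmallSet X k) :
    K.list.length ≤ k := by
  simpa [SmallSet.list, length_enum] using K.2

open Classical in
/-- The partial function that an element of `κ` describes. -/
noncomputable def code {A X : RelStr.{0} σ} {B : RelStr.{0} τ} {k : ℕ} {t : τ.Ty}
    (p : PreDom k X A B t) : FunTy A B k :=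
  ⟨t, ⟨p.1.list.map Sigma.fst, by simpa using p.1.length_list⟩, fun q =>
    if h : ∃ f : Surviving k X A p.1, f.1.app (enum p.1.1) = q.1 then some (p.2 h.choose)
    else none⟩

/-- The image of an enumeration of the set determines the map, so the choice made in `code` returns
f. -/
theorem code_apply {A X : RelStr.{0} σ} {B : RelStr.{0} τ} {k : ℕ} {t : τ.Ty}
    (p : PreDom k X A B t) (f : Surviving k X A p.1) (q : Tup A (code p).2.1.1)
    (hq : f.1.app (enum p.1.1) = q.1) :
    (code p).2.2 q = some (p.2 f) := by
  have h : ∃ f : Surviving k X A p.1, f.1.app (enum p.1.1) = q.1 := ⟨f, hq⟩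
  have hf : h.choose = f :=
    Subtype.ext (PartialMap.eq_of_app_eq mem_enum (h.choose_spec.trans hq.symm))
  exact (dif_pos h).trans (congrArg (fun f => some (p.2 f)) hf)

/-! ### The canonical interpretation compared with `kappa` -/

section

variable [Finite σ.Ty] [Finite σ.Sym] {A : RelStr.{0} σ} [∀ t, Finite (A.Dom t)]
  {B : RelStr.{0} τ} {k N : ℕ} {X : RelStr.{0} σ}

/-- The interpretation by canonical programs. -/
noncomputable def funInterp (A : RelStr.{0} σ) [∀ t, Finite (A.Dom t)] (B : RelStr.{0} τ)
    (hk : k ≤ N) (hN : ∀ S, ((τ.ar S).length + 1) * k ≤ N) :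
    Interpretation σ (funSig A B k) where
  tyProg i := canon A N (.inr (domIdb hk i))
  symProg R := canon A N (.inr (relIdb hN R))
  arity_eq _ := rfl

variable (hk : k ≤ N) (hN : ∀ S, ((τ.ar S).length + 1) * k ≤ N)

/-- The image in `A` of an element of the interpreted structure, under a homomorphism. -/
def Hom.funTup (h : Hom X A) (x : ((funInterp A B hk hN).apply X).Elem) : FunTup A B k :=
  ⟨x.1, x.2.1.map fun y => ⟨y.1, h.toFun y.1 y.2⟩, (Canon.sat_map x.2.2 h).1⟩

theorem Hom.isSome_funTup (h : Hom X A) (x : ((funInterp A B hk hN).apply X).Elem) :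
    (x.1.2.2 (h.funTup hk hN x).2).isSome :=
  (Canon.sat_map x.2.2 h).2

/-- The canonical interpretation preserves positive instances. -/
theorem homTo_of_homTo (h : HomTo X A) :
    HomTo ((funGadget A B k).apply ((funInterp A B hk hN).apply X)) B := by
  obtain ⟨h⟩ := h
  let val : ∀ x : ((funInterp A B hk hN).apply X).Elem, B.Dom x.1.1 :=
    fun x => (x.1.2.2 (h.funTup hk hN x).2).get (h.isSome_funTup hk hN x)
  have hval : ∀ x, (h.funTup hk hN x).val = some ⟨x.1.1, val x⟩ := fun x => by
    change Option.map _ (x.1.2.2 (h.funTup hk hN x).2) = _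
    rw [← Option.some_get (h.isSome_funTup hk hN x)]
    rfl
  refine ⟨⟨fun t x => x.2 ▸ val x.1, ?_⟩⟩
  rintro _ _ ⟨R, rfl, w, ⟨hty, hd⟩, rfl⟩
  refine Eq.mp (congrArg (· ∈ B.rel R.1) (map_eq_map_map w _ _
    (fun x => (⟨x.1.1, val x⟩ : B.Elem)) fun x => rfl)) ?_
  obtain ⟨_, w', hw', hf, z, hz, hzw⟩ := Canon.sat_map hd h
  -- Soundness yields some decomposition of the concatenated image; it has to be the one coming from
  -- w.
  have hww : w' = w.map (h.funTup hk hN) := by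
    apply FunTup.eq_of_flatMap_eq
    · exact hw'.trans (hty.symm.trans
        (map_eq_map_map w (h.funTup hk hN) Sigma.fst _ fun _ => rfl))
    · rw [hf, List.flatMap_map]
      exact List.map_flatMap
  rw [hww, List.map_map] at hzw
  have : z = w.map fun x => (⟨x.1.1, val x⟩ : B.Elem) := by
    apply List.map_injective_iff.2 (Option.some_injective _)
    rw [hzw, List.map_map]
    exact List.map_congr_left fun x _ => hval x
  rwa [← this]

/-- Consistent maps survive, so the partial function is defined at all their images; completeness
then derives its domain. -/
theorem canon_code {t : τ.Ty} (p : PreDom k X A B t) :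
    Canon A N X (.inr (domIdb hk (code p))) p.1.list := by
  refine canon_of_forall_consistent (p.1.2.trans hk) _ (enum p.1.1) rfl fun h hh => ?_
  refine ⟨PartialMap.map_fst_app _ _, ?_⟩
  exact Option.isSome_iff_exists.2 ⟨_, code_apply p ⟨h, hh.not_removed hk⟩ _ rfl⟩

/-- The element of the interpreted structure that represents an element of `κ`. -/
noncomputable def codeElem {t : τ.Ty} (p : PreDom k X A B t) :
    ((funInterp A B hk hN).apply X).Elem :=
  ⟨code p, p.1.list, canon_code hk p⟩

/-- The output of the consistency reduction maps to that of the canonical interpretation. -/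
theorem kappa_homTo (hk3 : 3 * k ≤ N) :
    HomTo (kappa k A B X) ((funGadget A B k).apply ((funInterp A B hk hN).apply X)) := by
  classical
  refine ⟨⟨fun t q => ⟨codeElem hk hN (Quot.out q), rfl⟩, ?_⟩⟩
  rintro S _ ⟨K, (l : List (Σ t, (Surviving k X A K → B.Dom t))), ⟨hlty, hl⟩, rfl⟩
  let rep : ∀ x : (Σ t, (Surviving k X A K → B.Dom t)), PreDom k X A B x.1 :=
    fun x => Quot.out (Quot.mk (Glue k X A B x.1) ⟨K, x.2⟩)
  have hrep : ∀ x, Relation.EqvGen (Glue k X A B x.1) (rep x) ⟨K, x.2⟩ := fun x =>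
    Quot.eqvGen_exact (Quot.out_eq _)
  have hlty' : l.map (fun x => x.1) = τ.ar S := hlty
  let R : FunSym A B k := ⟨S, l.map fun x => code (rep x), by
    rw [← hlty', List.map_map]
    rfl⟩
  refine Eq.mp (congrArg (· ∈ ((funGadget A B k).apply ((funInterp A B hk hN).apply X)).rel S)
    (map_eq_map_map l _ _ (fun x => (funGadget A B k).inj (codeElem hk hN (rep x)))
      fun x => rfl)) ?_
  refine (funGadget A B k).map_mem (R := R)
    ((funInterp A B hk hN).map_mem (F := fun x => codeElem hk hN (rep x)) rfl ?_)
  change Canon A N X (.inr (relIdb hN R)) (l.flatMap fun x => (rep x).1.list)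
  set c := l.flatMap fun x => (rep x).1.list with hc
  -- The chosen representatives live on sets unrelated to the common K of the tuple. M holds K and
  -- one such set per entry, which accounts for the bound (arity + 1) * k.
  let M : Finset X.Elem := K.1 ∪ c.toFinset
  have hcM : ∀ y ∈ c, y ∈ M := fun y hy =>
    Finset.mem_union_right _ (List.mem_toFinset.2 hy)
  have hsub : ∀ x ∈ l, (rep x).1.1 ⊆ M := fun x hx y hy =>
    hcM y (List.mem_flatMap.2 ⟨x, hx, SmallSet.mem_list.2 hy⟩)
  have hM : M.card ≤ N := by
    have h1 := Finset.card_union_le K.1 c.toFinset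
    have h2 := c.toFinset_card_le
    have h3 : c.length ≤ l.length * k := by
      rw [hc, List.length_flatMap]
      refine (List.sum_le_card_nsmul _ k ?_).trans (by simp)
      intro n hn
      obtain ⟨x, -, rfl⟩ := List.mem_map.1 hn
      exact (rep x).1.length_list
    have h4 : l.length = (τ.ar S).length := by rw [← hlty', List.length_map]
    have h5 := hN S
    have h6 := K.2
    rw [← h4, Nat.add_mul] at h5
    change (K.1 ∪ c.toFinset).card ≤ N
    omega
  have hR : c.map Sigma.fst = R.2.1.flatMap fun i => i.2.1.1 := by
    rw [hc, List.map_flatMap, List.flatMap_map]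
    rfl
  rw [← map_val_lift c hcM]
  refine canon_of_forall_consistent hM _ _ (by rw [map_val_lift]; exact hR) fun h hh => ?_
  refine ⟨by rw [PartialMap.map_fst_app, map_val_lift]; exact hR, ?_⟩
  have hKM : K.1 ⊆ M := Finset.subset_union_left
  let W : {x // x ∈ l} → FunTup A B k := fun x =>
    ⟨code (rep x.1), (h.restrict (hsub x.1 x.2)).app (enum (rep x.1).1.1),
      PartialMap.map_fst_app _ _⟩
  -- The tuple of `B` is read off on K, where the entries are related. It equals the tuple of values
  -- of the codes because h does not separate the representatives from the original elements.
  refine ⟨l.attach.map W, ?_, ?_, _, hl (hh.toSurviving hk K hKM), ?_⟩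
  · rw [List.map_map]
    change _ = l.map fun x => code (rep x)
    conv_rhs => rw [← l.attach_map_subtype_val, List.map_map]
    rfl
  · have hlist : ∀ x ∈ l, ∀ y ∈ (rep x).1.list, y ∈ M := fun x hx y hy =>
      hsub x hx (SmallSet.mem_list.1 hy)
    change _ = h.app (lift c hcM)
    rw [List.flatMap_map, lift_flatMap l _ hlist hcM, PartialMap.app, List.map_flatMap]
    refine congrArg (fun F => l.attach.flatMap F) (funext fun x => ?_)
    change (h.restrict (hsub x.1 x.2)).app (enum (rep x.1).1.1) = h.app (lift _ _)
    rw [PartialMap.restrict_app]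
    congr 1
    apply List.map_injective_iff.2 Subtype.val_injective
    rw [map_val_lift, List.map_map]
    rfl
  · rw [List.map_map, List.map_map]
    conv_lhs => rw [← l.attach_map_subtype_val, List.map_map]
    refine List.map_congr_left fun x _ => ?_
    have h1 := code_apply (rep x.1) (hh.toSurviving hk _ (hsub x.1 x.2)) (W x).2 rfl
    have h2 := hh.eq_of_eqvGen hk hk3 (hrep x.1) (hsub x.1 x.2) hKM
    rw [h2] at h1
    exact (congrArg (Option.map (Sigma.mk x.1.1)) h1).symm

end

theorem datalogReduces_of_consistencyReduces (hσ : σ.IsFinite) (hτ : τ.IsFinite)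
    {A : RelStr.{0} σ} {A' : RelStr.{u} σ} {B : RelStr.{0} τ} {B' : RelStr.{v} τ}
    (hA : A.IsFinite) (hB : B.IsFinite) {k : ℕ} (h : ConsistencyReduces k A A' B B') :
    DatalogReduces A A' B B' := by
  have := hσ.1
  have := hσ.2
  have := hτ.1
  have := hτ.2
  have : ∀ t, Finite (A.Dom t) := hA
  have : ∀ t, Finite (B.Dom t) := hB
  obtain ⟨m, hm⟩ := exists_nat_forall_le fun S => (τ.ar S).length
  -- N = (m + 3) * k serves both needs: 3 * k for chains of identifications and (m + 1) * k for
  -- related tuples.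
  have hk3 : 3 * k ≤ (m + 3) * k := Nat.mul_le_mul_right k (by omega)
  have hk : k ≤ (m + 3) * k := by omega
  have hN : ∀ S, ((τ.ar S).length + 1) * k ≤ (m + 3) * k := fun S =>
    Nat.mul_le_mul_right k (by have := hm S; omega)
  refine ⟨funSig A B k, ⟨inferInstanceAs (Finite (FunTy A B k)),
    inferInstanceAs (Finite (FunSym A B k))⟩, funInterp A B hk hN, funGadget A B k,
    fun X hX => ⟨homTo_of_homTo hk hN, fun hn hψ => (h X hX).2 hn ?_⟩⟩
  exact (kappa_homTo hk hN hk3).trans hψ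

end PCSP

theorem corollary3p4 {σ τ : PCSP.Signature} (hσ : σ.IsFinite) (hτ : τ.IsFinite)
    (A : PCSP.RelStr.{0} σ) (A' : PCSP.RelStr.{u} σ)
    (B : PCSP.RelStr.{0} τ) (B' : PCSP.RelStr.{v} τ)
    (hA : A.IsFinite) (hB : B.IsFinite)
    (hAA' : PCSP.HomTo A A') (hBB' : PCSP.HomTo B B') :
    PCSP.DatalogReduces A A' B B' ↔
      ∃ k : ℕ, 1 ≤ k ∧ PCSP.ConsistencyReduces k A A' B B' :=
  ⟨PCSP.exists_consistencyReduces hA, fun ⟨_, _, h⟩ =>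
    PCSP.datalogReduces_of_consistencyReduces hσ hτ hA hB h⟩
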